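/- **Theorem (Little).** For integers $l\ge 1$ let $\alpha_l$ and $\beta_l$ be the polynomials in $m$ given by $$\alpha_l(m)=\sum_{t=0}^{\lfloor l/2\rfloor}\binom{l}{2t}\prod_{\nu=m+1}^{m+t}(4\nu-1)\prod_{\nu=m-l+2t+1}^{m}(2\nu+1)\prod_{\nu=1}^{t-1}(4\nu+1),$$ $$\beta_l(m)=\sum_{t=1}^{\lfloor (l+1)/2\rfloor}\binom{l}{2t-1}\prod_{\nu=m+1}^{m+t-1}(4\nu+1)\prod_{\nu=m-l+2t}^{m}(2\nu+1)\prod_{\nu=1}^{t-1}(4\nu-1).$$ Here $m$ is an indeterminate, a product $\prod_{\nu=m+a}^{m+b}$ runs over $\nu=m+i$ with $i\in\mathbb Z$, $a\le i\le b$, and empty products equal $1$. Then for every $l\ge1$ all complex roots of $\alpha_l(m)=0$ lie on the line $\operatorname{Re} m=-\tfrac12$, and for every $l\ge2$ all complex roots of $\beta_l(m)=0$ lie on the same line. -/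

import Mathlib

/-- The polynomial
`α_l(m) = ∑_{t=0}^{⌊l/2⌋} C(l,2t) ∏_{ν=m+1}^{m+t} (4ν-1) ∏_{ν=m-l+2t+1}^{m} (2ν+1) ∏_{ν=1}^{t-1} (4ν+1)`
in the indeterminate `m = X`. The first product runs over `ν = X + i` with `1 ≤ i ≤ t`, the second
over `ν = X - j` with `0 ≤ j < l - 2t`. -/
noncomputable def alphaPoly (l : ℕ) : Polynomial ℤ :=
  ∑ t ∈ Finset.Icc 0 (l / 2),
    (l.choose (2 * t) : Polynomial ℤ)
      * (∏ i ∈ Finset.Icc 1 t, (4 * (Polynomial.X + (i : Polynomial ℤ)) - 1))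
      * (∏ j ∈ Finset.range (l - 2 * t), (2 * (Polynomial.X - (j : Polynomial ℤ)) + 1))
      * (∏ ν ∈ Finset.Ico 1 t, (4 * (ν : Polynomial ℤ) + 1))

/-- The polynomial
`β_l(m) = ∑_{t=1}^{⌊(l+1)/2⌋} C(l,2t-1) ∏_{ν=m+1}^{m+t-1} (4ν+1) ∏_{ν=m-l+2t}^{m} (2ν+1) ∏_{ν=1}^{t-1} (4ν-1)`
in the indeterminate `m = X`. The first product runs over `ν = X + i` with `1 ≤ i < t`, the second
over `ν = X - j` with `0 ≤ j < l - 2t + 1`. -/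
noncomputable def betaPoly (l : ℕ) : Polynomial ℤ :=
  ∑ t ∈ Finset.Icc 1 ((l + 1) / 2),
    (l.choose (2 * t - 1) : Polynomial ℤ)
      * (∏ i ∈ Finset.Ico 1 t, (4 * (Polynomial.X + (i : Polynomial ℤ)) + 1))
      * (∏ j ∈ Finset.range (l + 1 - 2 * t), (2 * (Polynomial.X - (j : Polynomial ℤ)) + 1))
      * (∏ ν ∈ Finset.Ico 1 t, (4 * (ν : Polynomial ℤ) - 1))

/-!
Put `M = 2m + 1`, so that the line `Re m = -1/2` becomes `Re M = 0`. Both families are binomial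
convolutions `S n = ∑_{i + j = n} C(n, i) e i * Q j`, where `Q` is the product
`M (M - 2) (M - 4) ⋯` (`stepFactorial`) and `e` is a solution of
`e (i + 2) = (2 i + 1) (2 M + 2 i + 1) e i` (`twoStep`): the initial values `(e 0, e 1) = (1, 0)` give
`α` and `(0, 1)` give `β`. Equivalently, the exponential generating function of `S` solves a
second-order equation of hypergeometric type, and this yields the three-term recurrence
`S (n + 2) = 2 M S (n + 1) + ((2 n + 1)² - M²) S n` (`binomConv_recurrence`).

Write `S (n + 1) / S n = M + t n`. The recurrence becomes
`t (n + 1) = (M t n + (2 n + 1)²) / (M + t n)`. For `Re M > 0` this Möbius transformation, whose fixed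
points are `± (2 n + 1)`, maps the closed right half-plane to itself, so `Re (M + t n) > 0` for
all `n` and no `S n` vanishes (`ne_zero_of_recurrence_of_re_pos`). The case `Re M < 0` follows, since
`(-1)ⁿ S n` satisfies the recurrence for `-M` (`ne_zero_of_recurrence`).
-/

open Finset

/-! ### Zero-free half-planes from the three-term recurrence -/

/-- The Möbius transformation `t ↦ (M t + c²) / (M + t)` preserves the closed right half-plane. -/
lemma re_moebius_nonneg {M t : ℂ} (c : ℝ) (hM : 0 < M.re) (ht : 0 ≤ t.re) :
    0 ≤ ((M * t + (c : ℂ) ^ 2) / (M + t)).re := by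
  rw [Complex.div_re, ← add_div]
  refine div_nonneg ?_ (Complex.normSq_nonneg _)
  have key : (M * t + (c : ℂ) ^ 2).re * (M + t).re + (M * t + (c : ℂ) ^ 2).im * (M + t).im
      = (t.re ^ 2 + t.im ^ 2) * M.re + (M.re ^ 2 + M.im ^ 2) * t.re + c ^ 2 * (M.re + t.re) := by
    simp only [← Complex.ofReal_pow, Complex.add_re, Complex.add_im, Complex.mul_re,
      Complex.mul_im, Complex.ofReal_re, Complex.ofReal_im]
    ring
  rw [key]
  positivity

/-- With `u (n + 1) = (M + t n) u n`, the hypothesis `h1` says `t 0 = r M`, and `re_moebius_nonneg`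
carries `0 ≤ Re (t n)` from each `n` to the next. -/
lemma ne_zero_of_recurrence_of_re_pos {M : ℂ} (hM : 0 < M.re) {u : ℕ → ℂ} {c : ℕ → ℝ} {r : ℝ}
    (hr : 0 ≤ r) (h0 : u 0 ≠ 0) (h1 : u 1 = (1 + r) * M * u 0)
    (hu : ∀ n, u (n + 2) = 2 * M * u (n + 1) + ((c n : ℂ) ^ 2 - M ^ 2) * u n) (n : ℕ) :
    u n ≠ 0 := by
  suffices h : u n ≠ 0 ∧ ∃ t : ℂ, 0 ≤ t.re ∧ u (n + 1) = (M + t) * u n from h.1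
  induction n with
  | zero =>
    refine ⟨h0, r * M, ?_, by rw [h1]; ring⟩
    rw [Complex.re_ofReal_mul]
    positivity
  | succ n ih =>
    obtain ⟨hn, t, ht, hstep⟩ := ih
    have hMt : M + t ≠ 0 := fun h => by
      have := congrArg Complex.re h
      simp only [Complex.add_re, Complex.zero_re] at this
      linarith
    refine ⟨hstep ▸ mul_ne_zero hMt hn, _, re_moebius_nonneg (c n) hM ht, ?_⟩
    rw [hu, hstep]
    field_simp
    ring

lemma ne_zero_of_recurrence {M : ℂ} (hM : M.re ≠ 0) {u : ℕ → ℂ} {c : ℕ → ℝ} {r : ℝ}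
    (hr : 0 ≤ r) (h0 : u 0 ≠ 0) (h1 : u 1 = (1 + r) * M * u 0)
    (hu : ∀ n, u (n + 2) = 2 * M * u (n + 1) + ((c n : ℂ) ^ 2 - M ^ 2) * u n) (n : ℕ) :
    u n ≠ 0 := by
  rcases hM.lt_or_gt with hneg | hpos
  · have h := ne_zero_of_recurrence_of_re_pos (M := -M) (by simpa using hneg)
      (u := fun k => (-1) ^ k * u k) (c := c) hr (by simpa using h0) (by simp [h1])
      (fun k => by simp only [hu, pow_succ]; ring) n
    exact right_ne_zero_of_mul h
  · exact ne_zero_of_recurrence_of_re_pos hpos hr h0 h1 hu n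

/-! ### The three-term recurrence of the binomial convolution -/

section Recurrence

variable {R : Type*} [CommRing R]

/-- The descending product `M (M - 2) (M - 4) ⋯` with `k` factors. -/
def stepFactorial (M : R) (k : ℕ) : R := ∏ j ∈ range k, (M - 2 * j)

lemma stepFactorial_succ (M : R) (k : ℕ) :
    stepFactorial M (k + 1) = stepFactorial M k * (M - 2 * k) := prod_range_succ _ _

/-- The solution of `e (i + 2) = (2 i + 1) (2 M + 2 i + 1) e i` with `e 0 = a` and `e 1 = b`. -/
def twoStep (a b M : R) : ℕ → R
  | 0 => a
  | 1 => b
  | i + 2 => (2 * i + 1) * (2 * M + 2 * i + 1) * twoStep a b M i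

/-- The binomial convolution of `twoStep a b M` and `stepFactorial M`. -/
def binomConv (a b M : R) (n : ℕ) : R :=
  ∑ p ∈ antidiagonal n, (n.choose p.1 : R) * (twoStep a b M p.1 * stepFactorial M p.2)

/-- Absorption: `C(n, i) (n - i) = C(n, i + 1) (i + 1)`, summed against a function. -/
lemma sum_antidiagonal_choose_mul_snd (f : ℕ → ℕ → R) (n : ℕ) :
    ∑ p ∈ antidiagonal n, (n.choose p.1 : R) * (p.2 * f (p.1 + 1) p.2)
      = ∑ p ∈ antidiagonal n, (n.choose p.1 : R) * (p.1 * f p.1 (p.2 + 1)) := by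
  cases n with
  | zero => simp
  | succ n =>
    rw [Nat.sum_antidiagonal_succ', Nat.sum_antidiagonal_succ]
    simp only [Nat.cast_zero, zero_mul, mul_zero, zero_add]
    refine sum_congr rfl fun p hp => ?_
    have h := Nat.choose_succ_right_eq (n + 1) p.1
    rw [show n + 1 - p.1 = p.2 + 1 by have := mem_antidiagonal.1 hp; omega] at h
    have h' : ((n + 1).choose (p.1 + 1) : R) * (p.1 + 1 : ℕ)
        = ((n + 1).choose p.1 : R) * (p.2 + 1 : ℕ) := by
      exact_mod_cast congrArg (Nat.cast (R := R)) h
    rw [← mul_assoc, ← mul_assoc, h']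

theorem binomConv_recurrence (a b M : R) (n : ℕ) :
    binomConv a b M (n + 2)
      = 2 * M * binomConv a b M (n + 1) + ((2 * n + 1) ^ 2 - M ^ 2) * binomConv a b M n := by
  have pascal (f : ℕ → ℕ → R) (n : ℕ) :
      ∑ p ∈ antidiagonal (n + 1), ((n + 1).choose p.1 : R) * f p.1 p.2
        = ∑ p ∈ antidiagonal n, (n.choose p.1 : R) * (f p.1 (p.2 + 1) + f (p.1 + 1) p.2) := by
    rw [sum_antidiagonal_choose_succ_mul, ← sum_add_distrib]
    refine sum_congr rfl fun p hp => ?_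
    rw [Nat.choose_symm_of_eq_add (mem_antidiagonal.1 hp).symm]
    ring
  have absorb := sum_antidiagonal_choose_mul_snd
    (fun i j => 4 * (twoStep a b M i * stepFactorial M j)) n
  unfold binomConv
  rw [pascal (fun i j => twoStep a b M i * stepFactorial M j) (n + 1),
    pascal (fun i j => twoStep a b M i * stepFactorial M (j + 1)
      + twoStep a b M (i + 1) * stepFactorial M j) n,
    pascal (fun i j => twoStep a b M i * stepFactorial M j) n, mul_sum, mul_sum,
    ← sub_eq_zero, ← sum_add_distrib, ← sum_sub_distrib, ← sub_eq_zero.2 absorb.symm]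
  -- After moving it across, the left-hand side of `absorb` cancels all terms in `e (i + 1)`.
  rw [eq_sub_iff_add_eq, ← sum_add_distrib]
  refine sum_congr rfl fun p hp => ?_
  rw [← mem_antidiagonal.1 hp]
  simp only [stepFactorial_succ, twoStep]
  push_cast
  ring

end Recurrence

/-! ### Identification of the two families -/

lemma twoStep_even {R : Type*} [CommRing R] (a b M : R) (t : ℕ) :
    twoStep a b M (2 * t)
      = a * ((∏ i ∈ Icc 1 t, (2 * M + 4 * i - 3)) * ∏ ν ∈ Ico 1 t, (4 * (ν : R) + 1)) := by
  induction t with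
  | zero => simp [twoStep]
  | succ t ih =>
    rw [show 2 * (t + 1) = 2 * t + 2 by ring, twoStep, ih, prod_Icc_succ_top (by omega)]
    rcases Nat.eq_zero_or_pos t with rfl | ht
    · simp; ring
    · rw [prod_Ico_succ_top ht]
      push_cast
      ring

lemma twoStep_odd {R : Type*} [CommRing R] (a b M : R) (t : ℕ) :
    twoStep a b M (2 * t + 1)
      = b * ((∏ i ∈ Ico 1 (t + 1), (2 * M + 4 * i - 1))
        * ∏ ν ∈ Ico 1 (t + 1), (4 * (ν : R) - 1)) := by
  induction t with
  | zero => simp [twoStep]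
  | succ t ih =>
    rw [show 2 * (t + 1) + 1 = 2 * t + 1 + 2 by ring, twoStep, ih,
      prod_Ico_succ_top (by omega : 1 ≤ t + 1), prod_Ico_succ_top (by omega : 1 ≤ t + 1)]
    push_cast
    ring

lemma aeval_alphaPoly (l : ℕ) (m : ℂ) :
    Polynomial.aeval m (alphaPoly l) = binomConv 1 0 (2 * m + 1) l := by
  rw [binomConv, Nat.sum_antidiagonal_eq_sum_range_succ_mk, alphaPoly, map_sum]
  refine sum_of_injOn (fun t => 2 * t) (fun _ _ _ _ h => by simpa using h)
    (fun t ht => by simp at ht ⊢; omega) (fun j hj hj' => ?_) fun t _ => ?_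
  · -- Odd indices do not contribute, because `twoStep` starts with `e 1 = 0`.
    obtain ⟨t, rfl | rfl⟩ := Nat.even_or_odd' j
    · exact absurd ⟨t, by simp at hj ⊢; omega, rfl⟩ hj'
    · simp [twoStep_odd]
  · simp only [map_mul, map_prod, map_add, map_sub, map_natCast, map_one, map_ofNat,
      Polynomial.aeval_X, twoStep_even, stepFactorial]
    simp only [show ∀ i : ℂ, 4 * (m + i) - 1 = 2 * (2 * m + 1) + 4 * i - 3 from fun i => by ring,
      show ∀ j : ℂ, 2 * (m - j) + 1 = 2 * m + 1 - 2 * j from fun j => by ring]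
    ring

lemma aeval_betaPoly (l : ℕ) (m : ℂ) :
    Polynomial.aeval m (betaPoly l) = binomConv 0 1 (2 * m + 1) l := by
  rw [binomConv, Nat.sum_antidiagonal_eq_sum_range_succ_mk, betaPoly, map_sum]
  refine sum_of_injOn (fun t => 2 * t - 1)
    (fun s hs t ht h => by simp at hs ht h; omega)
    (fun t ht => by simp at ht ⊢; omega) (fun j hj hj' => ?_) fun t ht => ?_
  · -- Even indices do not contribute, because `twoStep` starts with `e 0 = 0`.
    obtain ⟨t, rfl | rfl⟩ := Nat.even_or_odd' j
    · simp [twoStep_even]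
    · exact absurd ⟨t + 1, by simp at hj ⊢; omega, by simp; omega⟩ hj'
  · obtain ⟨s, rfl⟩ : ∃ s, t = s + 1 := ⟨t - 1, by simp at ht; omega⟩
    rw [show l + 1 - 2 * (s + 1) = l - (2 * s + 1) by omega,
      show 2 * (s + 1) - 1 = 2 * s + 1 by omega]
    simp only [map_mul, map_prod, map_add, map_sub, map_natCast, map_one, map_ofNat,
      Polynomial.aeval_X, twoStep_odd, stepFactorial]
    simp only [show ∀ i : ℂ, 4 * (m + i) + 1 = 2 * (2 * m + 1) + 4 * i - 1 from fun i => by ring,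
      show ∀ j : ℂ, 2 * (m - j) + 1 = 2 * m + 1 - 2 * j from fun j => by ring]
    ring

theorem mainTheorem9 :
    (∀ l : ℕ, 1 ≤ l → ∀ m : ℂ, Polynomial.aeval m (alphaPoly l) = 0 → m.re = -(1 / 2)) ∧
    (∀ l : ℕ, 2 ≤ l → ∀ m : ℂ, Polynomial.aeval m (betaPoly l) = 0 → m.re = -(1 / 2)) := by
  have line {m : ℂ} (h : ¬ m.re = -(1 / 2)) : (2 * m + 1).re ≠ 0 := fun h' => h <| by
    simp at h'
    linarith
  refine ⟨fun l _ m hm => ?_, fun l hl m hm => ?_⟩ <;> by_contra hre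
  · rw [aeval_alphaPoly] at hm
    refine ne_zero_of_recurrence (line hre) (u := binomConv 1 0 (2 * m + 1))
      (c := fun n => 2 * n + 1) (r := 0) le_rfl ?_ ?_ (fun n => ?_) l hm
    · simp [binomConv, twoStep, stepFactorial]
    · simp [binomConv, twoStep, stepFactorial, Nat.antidiagonal_succ]
    · rw [binomConv_recurrence]
      push_cast
      ring
  · -- The convolution vanishes at index `0`, so the recurrence is started at index `1`.
    obtain ⟨k, rfl⟩ : ∃ k, l = k + 1 := ⟨l - 1, by omega⟩
    rw [aeval_betaPoly] at hm
    have h0 : binomConv 0 1 (2 * m + 1) 0 = 0 := by simp [binomConv, twoStep]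
    have h1 : binomConv 0 1 (2 * m + 1) 1 = 1 := by
      simp [binomConv, twoStep, stepFactorial, Nat.antidiagonal_succ]
    refine ne_zero_of_recurrence (line hre) (u := fun n => binomConv 0 1 (2 * m + 1) (n + 1))
      (c := fun n => 2 * n + 3) (r := 1) zero_le_one ?_ ?_ (fun n => ?_) k hm
    · simp [h1]
    · rw [binomConv_recurrence 0 1 (2 * m + 1) 0, h0, h1]
      push_cast
      ring
    · rw [binomConv_recurrence]
      push_cast
      ring
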